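/- For an integer $n\ge 1$ let $D_n=\langle r,s\mid r^n=s^2=1,\ sr=r^{-1}s\rangle$ be the dihedral group of order $2n$, and let $\Gamma_n$ be its generating graph: the simple graph whose vertices are the elements of $D_n$, two distinct elements being adjacent if and only if together they generate $D_n$. Let $L(n)=D-A$ be the Laplacian matrix of $\Gamma_n$, where $A$ is the adjacency matrix and $D$ is the diagonal matrix of vertex degrees. Let $\varphi$ be Euler's totient function, $\mu$ the Möbius function, and $n_0$ the product of the distinct primes dividing $n$ (so $n_0=1$ if $n=1$). **Theorem.** For every integer $n\ge 1$, the spectrum of $L(n)$, as a multiset of $2n$ real numbers, consists of - $0$ with multiplicity $n-\varphi(n)+1$; - for each divisor $d>1$ of $n_0$, the number $2\varphi(n)-\mu(d)\,\dfrac{\varphi(n)}{\varphi(d)}$ with multiplicity $\varphi(d)$; - $2\varphi(n)$ with multiplicity $n-n_0$; - $n$ with multiplicity $\varphi(n)-1$; - $n+\varphi(n)$ with multiplicity $1$. If some of the listed numbers coincide, their multiplicities are added; a number listed with multiplicity $0$ does not count. In particular, all eigenvalues of $L(n)$ are integers, that is, $\Gamma_n$ is Laplacian integral for every $n\ge1$.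 -/

import Mathlib

/-- The generating graph of a group `G`: the vertices are the elements of `G`, and two distinct
elements are adjacent iff together they generate `G`. -/
def generatingGraph (G : Type*) [Group G] : SimpleGraph G where
  Adj x y := x ≠ y ∧ Subgroup.closure ({x, y} : Set G) = ⊤
  symm := ⟨fun x y h => ⟨h.1.symm, by rw [Set.pair_comm]; exact h.2⟩⟩
  loopless := ⟨fun _ h => h.1 rfl⟩

/-- The spectrum of the Laplacian matrix `L = D - A` of a finite graph, as the multiset of its
eigenvalues counted with multiplicity. (`L` is real symmetric, so all its eigenvalues are real and
their algebraic and geometric multiplicities agree.) -/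
noncomputable def laplacianSpectrum {V : Type*} [Fintype V] [DecidableEq V]
    (Γ : SimpleGraph V) [DecidableRel Γ.Adj] : Multiset ℝ :=
  (Γ.lapMatrix ℝ).charpoly.roots

/-- A finite graph is Laplacian integral if all eigenvalues of its Laplacian are integers. -/
def IsLaplacianIntegral {V : Type*} [Fintype V] [DecidableEq V]
    (Γ : SimpleGraph V) [DecidableRel Γ.Adj] : Prop :=
  ∀ x ∈ laplacianSpectrum Γ, ∃ z : ℤ, x = (z : ℝ)

/-- The squarefree kernel of `n`, i.e. the product of the distinct primes dividing `n`. -/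
def squarefreeKernel (n : ℕ) : ℕ := ∏ p ∈ n.primeFactors, p

/-! Split the vertices into rotations and reflections. Two rotations never generate; a rotation and
a reflection do iff the exponent is a unit mod `n`, two reflections iff their difference is. So `L`
has a diagonal rotation block, a circulant reflection block, and off-diagonal blocks recording
units. For `x ≠ 0, n` the Schur complement of the rotation block in `x - L` is again circulant,
since only a constant matrix is subtracted, and the discrete Fourier transform gives its determinant
(`ZMod.det_circulant`). The factor at frequency `k` involves a Ramanujan sum, which by Hölder's
formula (`ZMod.sum_units_stdAddChar_mul`) depends only on the additive order `d` of `k`; there are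
`φ(d)` such `k`. Orders that are not squarefree have `μ(d) = 0` and merge into the eigenvalue
`2φ(n)`, while `k = 0` yields `n + φ(n)` and one more zero. -/

/-! ### Ramanujan sums over `ZMod n`. -/

theorem ZMod.addOrderOf_units_mul {n : ℕ} (u : (ZMod n)ˣ) (a : ZMod n) :
    addOrderOf ((u : ZMod n) * a) = addOrderOf a :=
  addOrderOf_injective (DistribSMul.toAddMonoidHom (ZMod n) u) (MulAction.injective u) a

/-- Every residue is a unit times a divisor of `n`, and its order determines that divisor. -/
theorem ZMod.exists_unit_mul_eq_of_addOrderOf_eq {n : ℕ} [NeZero n] {a b : ZMod n}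
    (h : addOrderOf a = addOrderOf b) : ∃ u : (ZMod n)ˣ, b = u * a := by
  have key : ∀ a : ZMod n, ∃ u : (ZMod n)ˣ, a = u * ((n / addOrderOf a : ℕ) : ZMod n) := by
    intro a
    obtain ⟨d, hd, u, hu, rfl⟩ := ZMod.eq_unit_mul_divisor a
    obtain ⟨u, rfl⟩ := hu
    refine ⟨u, ?_⟩
    rw [ZMod.addOrderOf_units_mul, ZMod.addOrderOf_coe _ (NeZero.ne n), Nat.gcd_eq_right hd,
      Nat.div_div_self hd (NeZero.ne n)]
  obtain ⟨u, hu⟩ := key a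
  obtain ⟨v, hv⟩ := key b
  refine ⟨v * u⁻¹, ?_⟩
  rw [hv, ← h]
  conv_rhs => rw [hu]
  simp [mul_assoc]

theorem ZMod.card_addOrderOf_eq_totient {n d : ℕ} [NeZero n] (hd : d ∣ n) :
    (Finset.univ.filter fun k : ZMod n => addOrderOf k = d).card = d.totient :=
  IsAddCyclic.card_addOrderOf_eq_totient (by rwa [ZMod.card])

theorem ZMod.sum_stdAddChar_of_addOrderOf_dvd {n d : ℕ} [NeZero n] (hd : d ∣ n) :
    ∑ k : ZMod n with addOrderOf k ∣ d, ZMod.stdAddChar k = if d = 1 then 1 else 0 := by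
  split_ifs with h1
  · subst h1
    have : (Finset.univ.filter fun k : ZMod n => addOrderOf k ∣ 1) = {0} := by
      ext k; simp
    rw [this, Finset.sum_singleton, AddChar.map_zero_eq_one]
  · obtain ⟨g, hg⟩ : ∃ g : ZMod n, addOrderOf g = d := by
      have : 0 < (Finset.univ.filter fun k : ZMod n => addOrderOf k = d).card := by
        rw [ZMod.card_addOrderOf_eq_totient hd, Nat.totient_pos]
        exact Nat.pos_of_dvd_of_pos hd (NeZero.pos n)
      obtain ⟨g, hg⟩ := Finset.card_pos.1 this
      exact ⟨g, by simpa using hg⟩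
    have hg0 : ZMod.stdAddChar g ≠ 1 := by
      intro h
      rw [← AddChar.map_zero_eq_one (ZMod.stdAddChar (N := n))] at h
      have := ZMod.injective_stdAddChar h
      simp [this] at hg
      exact h1 hg.symm
    -- Translation by `g` permutes the subgroup summed over, so the sum is fixed by multiplication
    -- by a number other than 1.
    have hs : ∑ k : ZMod n with addOrderOf k ∣ d, ZMod.stdAddChar k
        = ZMod.stdAddChar g * ∑ k : ZMod n with addOrderOf k ∣ d, ZMod.stdAddChar k := by
      rw [Finset.mul_sum]
      symm
      refine Finset.sum_equiv (Equiv.addLeft g) (fun k => ?_) (fun k _ => ?_)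
      · have : d • g = 0 := by rw [← hg, addOrderOf_nsmul_eq_zero]
        simp [addOrderOf_dvd_iff_nsmul_eq_zero, this, -nsmul_eq_mul]
      · simp [AddChar.map_add_eq_mul]
    have h2 : (ZMod.stdAddChar g - 1) *
        ∑ k : ZMod n with addOrderOf k ∣ d, ZMod.stdAddChar k = 0 := by
      linear_combination -hs
    exact (mul_eq_zero.1 h2).resolve_left (sub_ne_zero.2 hg0)

/-- Möbius inversion, over divisors of `n`, of the preceding subgroup sums. -/
theorem ZMod.sum_stdAddChar_of_addOrderOf_eq {n d : ℕ} [NeZero n] (hd : d ∣ n) :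
    ∑ k : ZMod n with addOrderOf k = d, ZMod.stdAddChar k
      = (ArithmeticFunction.moebius d : ℂ) := by
  have h := (ArithmeticFunction.sum_eq_iff_sum_mul_moebius_eq_on (R := ℂ)
    (f := fun d => ∑ k : ZMod n with addOrderOf k = d, ZMod.stdAddChar k)
    (g := fun d => if d = 1 then 1 else 0) {d | d ∣ n}
    (fun a b hab hb => hab.trans hb)).1 (fun m hm hmn => by
      rw [← ZMod.sum_stdAddChar_of_addOrderOf_dvd hmn,
        ← Finset.sum_fiberwise_of_maps_to (g := fun k : ZMod n => addOrderOf k)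
          (t := m.divisors)]
      · refine Finset.sum_congr rfl fun e he => ?_
        rw [Finset.filter_filter]
        refine Finset.sum_congr (Finset.filter_congr fun k _ => ?_) fun _ _ => rfl
        constructor
        · rintro rfl; exact ⟨Nat.dvd_of_mem_divisors he, rfl⟩
        · exact fun h => h.2
      · intro k hk
        exact Nat.mem_divisors.2 ⟨by simpa using hk, hm.ne'⟩)
    d (Nat.pos_of_dvd_of_pos hd (NeZero.pos n)) hd
  rw [← h]
  have hd0 : d ≠ 0 := (Nat.pos_of_dvd_of_pos hd (NeZero.pos n)).ne'
  rw [Nat.sum_divisorsAntidiagonal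
    (f := fun a b => (ArithmeticFunction.moebius a : ℂ) * if b = 1 then 1 else 0),
    Finset.sum_eq_single_of_mem d (Nat.mem_divisors_self d hd0)]
  · simp [Nat.div_self (Nat.pos_of_ne_zero hd0)]
  · intro e he hne
    have : d / e ≠ 1 := fun h => hne (by
      have := Nat.div_mul_cancel (Nat.dvd_of_mem_divisors he)
      rw [h, one_mul] at this; exact this)
    simp [this]

/-- Hölder's evaluation of the Ramanujan sum. -/
theorem ZMod.sum_units_stdAddChar_mul {n : ℕ} [NeZero n] (k : ZMod n) :
    ∑ u : (ZMod n)ˣ, ZMod.stdAddChar ((u : ZMod n) * k)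
      = (ArithmeticFunction.moebius (addOrderOf k) : ℂ) * (n.totient : ℂ)
          / ((addOrderOf k).totient : ℂ) := by
  have hd : addOrderOf k ∣ n := by
    simpa [ZMod.card] using addOrderOf_dvd_card (x := k)
  have hφ : ((addOrderOf k).totient : ℂ) ≠ 0 :=
    Nat.cast_ne_zero.2 (Nat.totient_pos.2 (addOrderOf_pos k)).ne'
  rw [eq_div_iff hφ]
  -- The unit sum is constant on elements of equal order; summing it over all of them and exchanging
  -- sums counts the previous sum `φ(n)` times.
  calc _ = ∑ l : ZMod n with addOrderOf l = addOrderOf k,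
        ∑ u : (ZMod n)ˣ, ZMod.stdAddChar ((u : ZMod n) * l) := by
        have h : ∀ l ∈ Finset.univ.filter fun l : ZMod n => addOrderOf l = addOrderOf k,
            ∑ u : (ZMod n)ˣ, ZMod.stdAddChar ((u : ZMod n) * l)
              = ∑ u : (ZMod n)ˣ, ZMod.stdAddChar ((u : ZMod n) * k) := fun l hl => by
          obtain ⟨v, rfl⟩ := ZMod.exists_unit_mul_eq_of_addOrderOf_eq
            (Finset.mem_filter.1 hl).2.symm
          exact Fintype.sum_equiv (Equiv.mulRight v) _ _ fun u => by simp [mul_assoc]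
        rw [Finset.sum_congr rfl h, Finset.sum_const, ZMod.card_addOrderOf_eq_totient hd,
          nsmul_eq_mul, mul_comm]
    _ = ∑ u : (ZMod n)ˣ, ∑ l : ZMod n with addOrderOf l = addOrderOf k,
          ZMod.stdAddChar l := by
        rw [Finset.sum_comm]
        refine Finset.sum_congr rfl fun u _ => ?_
        refine Finset.sum_equiv (Units.mulLeft u) (fun l => ?_) fun l _ => by simp
        simp [ZMod.addOrderOf_units_mul]
    _ = _ := by
        rw [ZMod.sum_stdAddChar_of_addOrderOf_eq hd, Finset.sum_const, Finset.card_univ,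
          ZMod.card_units_eq_totient, nsmul_eq_mul, mul_comm]

theorem ZMod.sum_ite_isUnit {n : ℕ} [NeZero n] {M : Type*} [AddCommMonoid M]
    [DecidablePred (IsUnit : ZMod n → Prop)] (f : ZMod n → M) :
    ∑ i, (if IsUnit i then f i else 0) = ∑ u : (ZMod n)ˣ, f u := by
  symm
  refine Finset.sum_of_injOn (fun u : (ZMod n)ˣ => (u : ZMod n)) Units.val_injective.injOn
    (by simp) (fun i _ hi => ?_) (fun u _ => by simp)
  rw [if_neg]
  rintro ⟨u, rfl⟩
  exact hi ⟨u, by simp⟩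

/-! ### Circulant determinants. -/

/-- The determinant of a circulant matrix is the product of the values of the discrete Fourier
transform of its symbol. -/
theorem ZMod.det_circulant {n : ℕ} [NeZero n] (v : ZMod n → ℂ) :
    (Matrix.circulant v).det = ∏ k : ZMod n, ∑ m, v m * ZMod.stdAddChar (m * k) := by
  -- The columns of `F` are eigenvectors of every circulant matrix; `G` is its inverse up to the
  -- factor `n`.
  let F : Matrix (ZMod n) (ZMod n) ℂ := Matrix.of fun i k => ZMod.stdAddChar (-(i * k))
  let G : Matrix (ZMod n) (ZMod n) ℂ := Matrix.of fun k j => ZMod.stdAddChar (k * j)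
  have hFG : F * G = (n : ℂ) • (1 : Matrix (ZMod n) (ZMod n) ℂ) := by
    ext i j
    have h : ∀ k : ZMod n, F i k * G k j = ZMod.stdAddChar ((j - i) * k) := fun k => by
      simp only [F, G, Matrix.of_apply, ← AddChar.map_add_eq_mul]
      congr 1; ring
    rw [Matrix.mul_apply, Finset.sum_congr rfl fun k _ => h k]
    rcases eq_or_ne i j with rfl | hij
    · simp
    · rw [Matrix.smul_apply, Matrix.one_apply_ne hij, smul_zero]
      exact AddChar.sum_eq_zero_of_ne_one
        (ZMod.isPrimitive_stdAddChar n (sub_ne_zero.2 hij.symm))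
  have hF : F.det ≠ 0 := by
    intro h
    have := congrArg Matrix.det hFG
    rw [Matrix.det_mul, h, zero_mul, Matrix.det_smul, Matrix.det_one, mul_one] at this
    exact pow_ne_zero _ (Nat.cast_ne_zero.2 (NeZero.ne n)) this.symm
  have hCF : Matrix.circulant v * F
      = F * Matrix.diagonal fun k => ∑ m, v m * ZMod.stdAddChar (m * k) := by
    ext i k
    rw [Matrix.mul_apply, Matrix.mul_diagonal, Finset.mul_sum]
    refine Fintype.sum_equiv (Equiv.subLeft i) _ _ fun j => ?_
    simp only [F, Matrix.of_apply, Matrix.circulant_apply, Equiv.subLeft_apply]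
    rw [mul_left_comm, ← AddChar.map_add_eq_mul]
    congr 2; ring
  have := congrArg Matrix.det hCF
  rw [Matrix.det_mul, Matrix.det_mul, Matrix.det_diagonal, mul_comm] at this
  exact mul_left_cancel₀ hF this

/-! ### Adjacency in the generating graph. -/

namespace DihedralGroup

theorem not_generatingGraph_adj_r_r {n : ℕ} (i j : ZMod n) :
    ¬ (generatingGraph (DihedralGroup n)).Adj (r i) (r j) := by
  rintro ⟨-, h⟩
  have key : ∀ x : DihedralGroup n, x ∈ Subgroup.closure ({r i, r j} : Set (DihedralGroup n)) →
      ∃ k, x = r k := by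
    intro x hx
    induction hx using Subgroup.closure_induction with
    | mem x hx => rcases hx with rfl | rfl <;> exact ⟨_, rfl⟩
    | one => exact ⟨0, rfl⟩
    | mul x y _ _ hx hy =>
      obtain ⟨a, rfl⟩ := hx
      obtain ⟨b, rfl⟩ := hy
      exact ⟨a + b, r_mul_r a b⟩
    | inv x _ hx =>
      obtain ⟨a, rfl⟩ := hx
      exact ⟨-a, inv_r a⟩
  obtain ⟨k, hk⟩ := key (sr 0) (h ▸ Subgroup.mem_top _)
  cases hk

theorem closure_r_sr_eq_top_iff {n : ℕ} [NeZero n] (i j : ZMod n) :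
    Subgroup.closure ({r i, sr j} : Set (DihedralGroup n)) = ⊤ ↔ IsUnit i := by
  constructor
  · intro h
    -- These elements form a subgroup, and `r 1` lies in it only if `i` is invertible.
    have key : ∀ x : DihedralGroup n,
        x ∈ Subgroup.closure ({r i, sr j} : Set (DihedralGroup n)) →
        ∃ k, x = r (i * k) ∨ x = sr (j + i * k) := by
      intro x hx
      induction hx using Subgroup.closure_induction with
      | mem x hx =>
        rcases hx with rfl | rfl
        · exact ⟨1, by simp⟩
        · exact ⟨0, by simp⟩
      | one => exact ⟨0, by simp⟩
      | mul x y _ _ hx hy =>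
        obtain ⟨a, rfl | rfl⟩ := hx <;> obtain ⟨b, rfl | rfl⟩ := hy
        · exact ⟨a + b, Or.inl (by rw [r_mul_r]; ring_nf)⟩
        · exact ⟨b - a, Or.inr (by rw [r_mul_sr]; ring_nf)⟩
        · exact ⟨a + b, Or.inr (by rw [sr_mul_r]; ring_nf)⟩
        · exact ⟨b - a, Or.inl (by rw [sr_mul_sr]; ring_nf)⟩
      | inv x _ hx =>
        obtain ⟨a, rfl | rfl⟩ := hx
        · exact ⟨-a, Or.inl (by rw [inv_r]; ring_nf)⟩
        · exact ⟨a, Or.inr (inv_sr _)⟩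
    obtain ⟨k, hk | hk⟩ := key (r 1) (h ▸ Subgroup.mem_top _)
    · exact IsUnit.of_mul_eq_one k (r.inj hk).symm
    · cases hk
  · rintro ⟨u, rfl⟩
    set H := Subgroup.closure ({r (u : ZMod n), sr j} : Set (DihedralGroup n))
    have hr : ∀ m : ZMod n, r m ∈ H := fun m => by
      have h := H.pow_mem (Subgroup.subset_closure (Set.mem_insert _ _))
        ((u⁻¹ : (ZMod n)ˣ) * m : ZMod n).val
      rw [r_pow, ZMod.natCast_zmod_val, Units.mul_inv_cancel_left] at h
      exact h
    have hs : sr j ∈ H := Subgroup.subset_closure (by simp)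
    refine (Subgroup.eq_top_iff' H).2 fun x => ?_
    rcases x with m | m
    · exact hr m
    · have h := H.mul_mem hs (hr (m - j))
      rwa [sr_mul_r, add_sub_cancel] at h

theorem generatingGraph_adj_r_sr {n : ℕ} [NeZero n] (i j : ZMod n) :
    (generatingGraph (DihedralGroup n)).Adj (r i) (sr j) ↔ IsUnit i := by
  rw [← closure_r_sr_eq_top_iff i j]
  exact ⟨fun h => h.2, fun h => ⟨by simp, h⟩⟩

theorem generatingGraph_adj_sr_sr {n : ℕ} [NeZero n] (i j : ZMod n) :
    (generatingGraph (DihedralGroup n)).Adj (sr i) (sr j) ↔ i ≠ j ∧ IsUnit (i - j) := by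
  have h : Subgroup.closure ({sr i, sr j} : Set (DihedralGroup n))
      = Subgroup.closure {r (i - j), sr j} := by
    apply le_antisymm <;> rw [Subgroup.closure_le]
    · rintro x (rfl | rfl)
      · have := Subgroup.mul_mem (Subgroup.closure {r (i - j), sr j})
          (Subgroup.subset_closure (Set.mem_insert_of_mem _ rfl))
          (Subgroup.subset_closure (Set.mem_insert _ _))
        rwa [sr_mul_r, add_sub_cancel] at this
      · exact Subgroup.subset_closure (by simp)
    · rintro x (rfl | rfl)
      · have := Subgroup.mul_mem (Subgroup.closure {sr i, sr j})
          (Subgroup.subset_closure (Set.mem_insert_of_mem _ rfl))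
          (Subgroup.subset_closure (Set.mem_insert _ _))
        rwa [sr_mul_sr] at this
      · exact Subgroup.subset_closure (by simp)
  rw [← closure_r_sr_eq_top_iff (i - j) j, ← h]
  exact ⟨fun h => ⟨fun e => h.1 (e ▸ rfl), h.2⟩, fun h => ⟨fun e => h.1 (sr.inj e), h.2⟩⟩

end DihedralGroup

theorem ZMod.card_filter_isUnit {n : ℕ} [NeZero n]
    [DecidablePred (IsUnit : ZMod n → Prop)] :
    (Finset.univ.filter (IsUnit : ZMod n → Prop)).card = n.totient := by
  rw [Finset.card_filter, ZMod.sum_ite_isUnit, Finset.sum_const, Finset.card_univ,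
    ZMod.card_units_eq_totient, smul_eq_mul, mul_one]

/-! ### The Laplacian and its characteristic polynomial. -/

namespace DihedralGroup

open scoped Classical in
theorem degree_generatingGraph_r {n : ℕ} [NeZero n]
    [DecidableRel (generatingGraph (DihedralGroup n)).Adj]
    (K : Type*) [AddCommMonoidWithOne K] (i : ZMod n) :
    ((generatingGraph (DihedralGroup n)).degree (r i) : K) = if IsUnit i then (n : K) else 0 := by
  rw [SimpleGraph.degree_eq_sum_if_adj, ← equivSum.symm.sum_comp, Fintype.sum_sum_type]
  have h1 : ∀ j : ZMod n, equivSum.symm (Sum.inl j) = r j := fun _ => rfl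
  have h2 : ∀ j : ZMod n, equivSum.symm (Sum.inr j) = sr j := fun _ => rfl
  simp only [h1, h2, not_generatingGraph_adj_r_r, generatingGraph_adj_r_sr]
  by_cases hi : IsUnit i <;> simp [hi, ZMod.card]

-- The correction term is nonzero only for `n = 1`, where `0` is a unit but loops are excluded. It
-- cancels in the Laplacian, whose circulant block then has one formula for all `n`.
open scoped Classical in
theorem degree_generatingGraph_sr {n : ℕ} [NeZero n]
    [DecidableRel (generatingGraph (DihedralGroup n)).Adj]
    (K : Type*) [AddCommGroupWithOne K] (i : ZMod n) :
    ((generatingGraph (DihedralGroup n)).degree (sr i) : K)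
      = n.totient + n.totient - if IsUnit (0 : ZMod n) then 1 else 0 := by
  rw [SimpleGraph.degree_eq_sum_if_adj, ← equivSum.symm.sum_comp, Fintype.sum_sum_type]
  have h1 : ∀ j : ZMod n, equivSum.symm (Sum.inl j) = r j := fun _ => rfl
  have h2 : ∀ j : ZMod n, equivSum.symm (Sum.inr j) = sr j := fun _ => rfl
  simp only [h1, h2, (generatingGraph _).adj_comm (sr i) (r _), generatingGraph_adj_r_sr,
    generatingGraph_adj_sr_sr]
  have h3 : ∑ j : ZMod n, (if IsUnit j then (1 : K) else 0) = n.totient := by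
    rw [ZMod.sum_ite_isUnit]
    simp [ZMod.card_units_eq_totient]
  have h4 : ∑ j : ZMod n, (if i ≠ j ∧ IsUnit (i - j) then (1 : K) else 0)
      = n.totient - if IsUnit (0 : ZMod n) then 1 else 0 := by
    have h : ∀ j : ZMod n, (if i ≠ j ∧ IsUnit (i - j) then (1 : K) else 0)
        = (if IsUnit (i - j) then 1 else 0)
          - if i = j then (if IsUnit (0 : ZMod n) then 1 else 0) else 0 := fun j => by
      rcases eq_or_ne i j with rfl | hij
      · simp
      · simp [hij]
    rw [Finset.sum_congr rfl fun j _ => h j, Finset.sum_sub_distrib, Finset.sum_ite_eq,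
      if_pos (Finset.mem_univ i), ← h3,
      ← (Equiv.subLeft i).sum_comp fun j : ZMod n => if IsUnit j then (1 : K) else 0]
    rfl
  rw [h3, h4, add_sub_assoc]

open scoped Classical in
theorem lapMatrix_generatingGraph {n : ℕ} [NeZero n]
    [DecidableRel (generatingGraph (DihedralGroup n)).Adj] (K : Type*) [CommRing K] :
    ((generatingGraph (DihedralGroup n)).lapMatrix K).submatrix equivSum.symm equivSum.symm
      = Matrix.fromBlocks
          (Matrix.diagonal fun i => if IsUnit i then (n : K) else 0)
          (Matrix.of fun i _ => if IsUnit i then -1 else 0)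
          (Matrix.of fun _ j => if IsUnit j then -1 else 0)
          (Matrix.circulant fun m => (if m = 0 then 2 * (n.totient : K) else 0)
            - if IsUnit m then 1 else 0) := by
  have h1 : ∀ j : ZMod n, equivSum.symm (Sum.inl j) = r j := fun _ => rfl
  have h2 : ∀ j : ZMod n, equivSum.symm (Sum.inr j) = sr j := fun _ => rfl
  ext (i | i) (j | j) <;>
    simp only [Matrix.submatrix_apply, h1, h2, SimpleGraph.lapMatrix, SimpleGraph.degMatrix,
      Matrix.sub_apply, SimpleGraph.adjMatrix_apply, Matrix.fromBlocks_apply₁₁,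
      Matrix.fromBlocks_apply₁₂, Matrix.fromBlocks_apply₂₁, Matrix.fromBlocks_apply₂₂,
      Matrix.of_apply, Matrix.circulant_apply, not_generatingGraph_adj_r_r,
      generatingGraph_adj_r_sr, generatingGraph_adj_sr_sr, Matrix.diagonal_apply,
      degree_generatingGraph_r, degree_generatingGraph_sr, if_false, sub_zero,
      (generatingGraph _).adj_comm (sr _) (r _), r.injEq, sr.injEq, reduceCtorEq, zero_sub]
  · split_ifs <;> simp
  · split_ifs <;> simp
  · rcases eq_or_ne i j with rfl | hij
    · simp; ring
    · simp [hij, sub_eq_zero]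

theorem det_fromBlocks_diagonal_unit_circulant {n : ℕ} [NeZero n]
    [DecidablePred (IsUnit : ZMod n → Prop)] {x : ℂ} (hx : x ≠ 0) (hxn : x ≠ n) :
    (Matrix.fromBlocks
      (Matrix.diagonal fun i : ZMod n => x - if IsUnit i then (n : ℂ) else 0)
      (Matrix.of fun i (_ : ZMod n) => if IsUnit i then 1 else 0)
      (Matrix.of fun (_ : ZMod n) j => if IsUnit j then 1 else 0)
      (Matrix.circulant fun m : ZMod n => (if m = 0 then x - 2 * (n.totient : ℂ) else 0)
        + if IsUnit m then 1 else 0)).det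
    = x ^ (n - n.totient) * (x - n) ^ n.totient
      * ∏ k : ZMod n, (x - 2 * n.totient
          + (ArithmeticFunction.moebius (addOrderOf k) : ℂ) * (n.totient : ℂ)
            / ((addOrderOf k).totient : ℂ)
          - if k = 0 then n * (n.totient / (x - n)) else 0) := by
  have ha : ∀ i : ZMod n, x - (if IsUnit i then (n : ℂ) else 0) ≠ 0 := fun i => by
    split_ifs
    · exact sub_ne_zero.2 hxn
    · simpa using hx
  let _ : Invertible (Matrix.diagonal fun i : ZMod n => x - if IsUnit i then (n : ℂ) else 0) :=
    invertibleOfLeftInverse _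
      (Matrix.diagonal fun i : ZMod n => (x - if IsUnit i then (n : ℂ) else 0)⁻¹) (by
        rw [Matrix.diagonal_mul_diagonal, ← Matrix.diagonal_one]
        congr 1
        ext i
        exact inv_mul_cancel₀ (ha i))
  rw [Matrix.det_fromBlocks₁₁]
  have hinv : ⅟(Matrix.diagonal fun i : ZMod n => x - if IsUnit i then (n : ℂ) else 0)
      = Matrix.diagonal fun i : ZMod n => (x - if IsUnit i then (n : ℂ) else 0)⁻¹ := rfl
  -- Each of the `φ(n)` units contributes `1 / (x - n)` to every entry of the correction, so it is a
  -- constant matrix.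
  have hS : (Matrix.circulant fun m : ZMod n => (if m = 0 then x - 2 * (n.totient : ℂ) else 0)
        + if IsUnit m then 1 else 0)
      - (Matrix.of fun (_ : ZMod n) j => if IsUnit j then 1 else 0)
        * ⅟(Matrix.diagonal fun i : ZMod n => x - if IsUnit i then (n : ℂ) else 0)
        * (Matrix.of fun i (_ : ZMod n) => if IsUnit i then 1 else 0)
      = Matrix.circulant fun m : ZMod n => (if m = 0 then x - 2 * (n.totient : ℂ) else 0)
        + (if IsUnit m then 1 else 0) - n.totient / (x - n) := by
    ext i j
    rw [Matrix.sub_apply, Matrix.mul_apply, hinv]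
    simp only [Matrix.mul_diagonal, Matrix.of_apply, Matrix.circulant_apply]
    congr 1
    have h : ∀ k : ZMod n, ((if IsUnit k then 1 else 0)
        * (x - if IsUnit k then (n : ℂ) else 0)⁻¹) * (if IsUnit k then 1 else 0)
        = if IsUnit k then (x - n)⁻¹ else 0 := fun k => by split_ifs <;> simp
    rw [Finset.sum_congr rfl fun k _ => h k, ZMod.sum_ite_isUnit, Finset.sum_const,
      Finset.card_univ, ZMod.card_units_eq_totient, nsmul_eq_mul, div_eq_mul_inv]
  rw [hS, Matrix.det_diagonal, ZMod.det_circulant]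
  congr 1
  · have hc : (Finset.univ.filter fun i : ZMod n => ¬ IsUnit i).card = n - n.totient := by
      rw [Finset.filter_not, Finset.card_sdiff_of_subset (Finset.filter_subset _ _),
        Finset.card_univ, ZMod.card, ZMod.card_filter_isUnit]
    have h : ∀ i : ZMod n, (x - if IsUnit i then (n : ℂ) else 0)
        = if IsUnit i then x - n else x := fun i => by split_ifs <;> simp
    rw [Finset.prod_congr rfl fun i _ => h i, Finset.prod_ite, Finset.prod_const,
      Finset.prod_const, ZMod.card_filter_isUnit, hc, mul_comm]
  · refine Finset.prod_congr rfl fun k _ => ?_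
    simp only [sub_mul, add_mul, Finset.sum_sub_distrib, Finset.sum_add_distrib, ite_mul,
      zero_mul, one_mul]
    rw [Finset.sum_ite_eq' Finset.univ (0 : ZMod n), ZMod.sum_ite_isUnit,
      ZMod.sum_units_stdAddChar_mul, ← Finset.mul_sum]
    simp only [Finset.mem_univ, if_true, zero_mul, AddChar.map_zero_eq_one, mul_one]
    congr 1
    -- A constant symbol has Fourier transform supported at `k = 0`.
    split_ifs with hk
    · simp [hk, mul_comm, ZMod.card]
    · rw [Finset.sum_congr rfl fun m _ => congrArg _ (mul_comm m k)]
      have h0 : ∑ m : ZMod n, ZMod.stdAddChar (k * m) = 0 :=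
        AddChar.sum_eq_zero_of_ne_one (ZMod.isPrimitive_stdAddChar n hk)
      rw [h0, mul_zero]

theorem eval_charpoly_lapMatrix_generatingGraph {n : ℕ} [NeZero n]
    [DecidableRel (generatingGraph (DihedralGroup n)).Adj] {x : ℂ} (hx : x ≠ 0) (hxn : x ≠ n) :
    ((generatingGraph (DihedralGroup n)).lapMatrix ℂ).charpoly.eval x
      = x ^ (n - n.totient + 1) * (x - n) ^ (n.totient - 1) * (x - (n + n.totient))
        * ∏ d ∈ n.divisors.erase 1, (x - (2 * (n.totient : ℂ)
          - (ArithmeticFunction.moebius d : ℂ) * (n.totient : ℂ) / (d.totient : ℂ)))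
            ^ d.totient := by
  classical
  have hL : ((Matrix.scalar (DihedralGroup n) x)
        - (generatingGraph (DihedralGroup n)).lapMatrix ℂ).submatrix equivSum.symm equivSum.symm
      = Matrix.fromBlocks
      (Matrix.diagonal fun i : ZMod n => x - if IsUnit i then (n : ℂ) else 0)
      (Matrix.of fun i (_ : ZMod n) => if IsUnit i then 1 else 0)
      (Matrix.of fun (_ : ZMod n) j => if IsUnit j then 1 else 0)
      (Matrix.circulant fun m : ZMod n => (if m = 0 then x - 2 * (n.totient : ℂ) else 0)
        + if IsUnit m then 1 else 0) := by
    have h : (Matrix.scalar (DihedralGroup n) x).submatrix equivSum.symm equivSum.symm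
        = Matrix.scalar (ZMod n ⊕ ZMod n) x := by
      simp [Matrix.scalar_apply, Matrix.submatrix_diagonal_equiv, Function.comp_def]
    rw [Matrix.submatrix_sub, Pi.sub_apply, Pi.sub_apply, h, lapMatrix_generatingGraph]
    ext (i | i) (j | j)
    · rcases eq_or_ne i j with rfl | hij <;> simp [*]
    · by_cases hi : IsUnit i <;> simp [hi]
    · by_cases hj : IsUnit j <;> simp [hj]
    · rcases eq_or_ne i j with rfl | hij
      · simp; ring
      · simp [hij, sub_eq_zero]
  have hn0 : 0 < n.totient := Nat.totient_pos.2 (NeZero.pos n)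
  have hxn' : x - n ≠ 0 := sub_ne_zero.2 hxn
  rw [Matrix.eval_charpoly, ← Matrix.det_submatrix_equiv_self equivSum.symm, hL,
    det_fromBlocks_diagonal_unit_circulant hx hxn,
    ← Finset.mul_prod_erase _ _ (Finset.mem_univ (0 : ZMod n))]
  have hprod : ∏ k ∈ Finset.univ.erase (0 : ZMod n), (x - 2 * n.totient
          + (ArithmeticFunction.moebius (addOrderOf k) : ℂ) * (n.totient : ℂ)
            / ((addOrderOf k).totient : ℂ)
          - if k = 0 then n * (n.totient / (x - n)) else 0)
      = ∏ d ∈ n.divisors.erase 1, (x - (2 * (n.totient : ℂ)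
          - (ArithmeticFunction.moebius d : ℂ) * (n.totient : ℂ) / (d.totient : ℂ)))
            ^ d.totient := by
    rw [← Finset.prod_fiberwise_of_maps_to (g := fun k : ZMod n => addOrderOf k)
      (t := n.divisors.erase 1)]
    · refine Finset.prod_congr rfl fun d hd => ?_
      have hd1 := Finset.ne_of_mem_erase hd
      have hf : (Finset.univ.erase (0 : ZMod n)).filter (fun k => addOrderOf k = d)
          = Finset.univ.filter fun k => addOrderOf k = d := by
        ext k
        simp only [Finset.mem_filter, Finset.mem_erase, Finset.mem_univ, and_true, true_and,
          and_iff_right_iff_imp]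
        rintro h rfl
        exact hd1 (by rw [← h, addOrderOf_zero])
      rw [hf, ← ZMod.card_addOrderOf_eq_totient (n := n) (d := d)
        (Nat.dvd_of_mem_divisors (Finset.mem_of_mem_erase hd)), ← Finset.prod_const]
      refine Finset.prod_congr rfl fun k hk => ?_
      have hk' := (Finset.mem_filter.1 hk).2
      have hk0 : k ≠ 0 := by
        rintro rfl
        exact hd1 (by rw [← hk', addOrderOf_zero])
      rw [if_neg hk0, hk', ZMod.card_addOrderOf_eq_totient
        (Nat.dvd_of_mem_divisors (Finset.mem_of_mem_erase hd))]
      ring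
    · intro k hk
      refine Finset.mem_erase.2 ⟨fun h => Finset.ne_of_mem_erase hk
        (AddMonoid.addOrderOf_eq_one_iff.1 h), Nat.mem_divisors.2 ⟨?_, NeZero.ne n⟩⟩
      simpa [ZMod.card] using addOrderOf_dvd_card (x := k)
  rw [hprod, ← mul_assoc]
  congr 1
  -- The factor at `k = 0` is `x - φ(n) - nφ(n)/(x - n) = x(x - n - φ(n))/(x - n)`; its denominator
  -- cancels one power of `x - n`.
  obtain ⟨m, hm⟩ : ∃ m, n.totient = m + 1 := ⟨n.totient - 1, by omega⟩
  simp only [addOrderOf_zero, if_true, ArithmeticFunction.moebius_apply_one, Nat.totient_one,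
    Int.cast_one, Nat.cast_one, one_mul, div_one]
  rw [show (x - n) ^ n.totient = (x - n) ^ (n.totient - 1) * (x - n) by
    rw [← pow_succ, Nat.sub_add_cancel hn0], pow_succ]
  field_simp
  ring

end DihedralGroup

/-! ### Squarefree and non-squarefree divisors. -/

theorem squarefree_squarefreeKernel (n : ℕ) : Squarefree (squarefreeKernel n) :=
  Finset.squarefree_prod_of_pairwise_isCoprime
    (fun _ hp _ hq hpq => Nat.coprime_iff_isRelPrime.1 <|
      (Nat.coprime_primes (Nat.prime_of_mem_primeFactors hp)
        (Nat.prime_of_mem_primeFactors hq)).2 hpq)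
    fun _ hp => (Nat.prime_of_mem_primeFactors hp).prime.squarefree

theorem squarefreeKernel_dvd (n : ℕ) : squarefreeKernel n ∣ n :=
  Nat.prod_primeFactors_dvd n

theorem divisors_squarefreeKernel {n : ℕ} (hn : n ≠ 0) :
    (squarefreeKernel n).divisors = n.divisors.filter Squarefree := by
  ext d
  have h0 : squarefreeKernel n ≠ 0 := (squarefree_squarefreeKernel n).ne_zero
  simp only [Nat.mem_divisors, Finset.mem_filter]
  constructor
  · rintro ⟨h, -⟩
    exact ⟨⟨h.trans (squarefreeKernel_dvd n), hn⟩,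
      (squarefree_squarefreeKernel n).squarefree_of_dvd h⟩
  · rintro ⟨⟨h, -⟩, hd⟩
    refine ⟨?_, h0⟩
    rw [← Nat.prod_primeFactors_of_squarefree hd]
    exact Finset.prod_dvd_prod_of_subset _ _ _ (Nat.primeFactors_mono h hn)

/-- Apply `∑ φ(d) = n` to both `n` and its kernel, whose divisors are the squarefree divisors of
`n`. -/
theorem sum_totient_divisors_not_squarefree {n : ℕ} (hn : n ≠ 0) :
    ∑ d ∈ n.divisors with ¬ Squarefree d, d.totient = n - squarefreeKernel n := by
  have h := Finset.sum_filter_add_sum_filter_not n.divisors Squarefree Nat.totient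
  rw [← divisors_squarefreeKernel hn, Nat.sum_totient, Nat.sum_totient] at h
  omega

theorem prod_divisors_erase_one_pow_totient {n : ℕ} (hn : n ≠ 0) {M : Type*} [CommMonoid M]
    (f : ℕ → M) (c : M) (hf : ∀ d, ¬ Squarefree d → f d = c) :
    ∏ d ∈ n.divisors.erase 1, f d ^ d.totient
      = (∏ d ∈ (squarefreeKernel n).divisors with 1 < d, f d ^ d.totient)
        * c ^ (n - squarefreeKernel n) := by
  rw [← Finset.prod_filter_mul_prod_filter_not (n.divisors.erase 1) Squarefree,
    ← sum_totient_divisors_not_squarefree hn, ← Finset.prod_pow_eq_pow_sum]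
  congr 1
  · refine Finset.prod_congr ?_ fun _ _ => rfl
    rw [divisors_squarefreeKernel hn]
    ext d
    simp only [Finset.mem_filter, Finset.mem_erase]
    constructor
    · rintro ⟨⟨h1, h2⟩, h3⟩
      have := Nat.pos_of_mem_divisors h2
      exact ⟨⟨h2, h3⟩, by omega⟩
    · rintro ⟨⟨h2, h3⟩, h1⟩
      exact ⟨⟨by omega, h2⟩, h3⟩
  · refine Finset.prod_congr ?_ fun d hd => by rw [hf d (Finset.mem_filter.1 hd).2]
    ext d
    simp only [Finset.mem_filter, Finset.mem_erase]
    constructor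
    · exact fun h => ⟨h.1.2, h.2⟩
    · rintro ⟨h1, h2⟩
      exact ⟨⟨fun h => h2 (h ▸ squarefree_one), h1⟩, h2⟩

/-! ### The spectrum and its integrality. -/

theorem mainTheorem1 (n : ℕ) [NeZero n]
    [DecidableRel (generatingGraph (DihedralGroup n)).Adj] :
    laplacianSpectrum (generatingGraph (DihedralGroup n)) =
        Multiset.replicate (n - Nat.totient n + 1) (0 : ℝ)
        + (∑ d ∈ (squarefreeKernel n).divisors with 1 < d,
            Multiset.replicate (Nat.totient d)
              (2 * (Nat.totient n : ℝ)
                - (ArithmeticFunction.moebius d : ℝ) * (Nat.totient n : ℝ)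
                    / (Nat.totient d : ℝ)))
        + Multiset.replicate (n - squarefreeKernel n) (2 * (Nat.totient n : ℝ))
        + Multiset.replicate (Nat.totient n - 1) (n : ℝ)
        + Multiset.replicate 1 ((n : ℝ) + (Nat.totient n : ℝ))
    ∧ IsLaplacianIntegral (generatingGraph (DihedralGroup n)) := by
  rw [and_iff_left_of_imp]
  · set S := _ + Multiset.replicate 1 ((n : ℝ) + (Nat.totient n : ℝ)) with hS
    suffices h : ((generatingGraph (DihedralGroup n)).lapMatrix ℝ).charpoly
        = (S.map fun a => Polynomial.X - Polynomial.C a).prod by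
      rw [laplacianSpectrum, h, Polynomial.roots_multiset_prod_X_sub_C]
    apply Polynomial.map_injective Complex.ofRealHom Complex.ofRealHom.injective
    have hmap : ((generatingGraph (DihedralGroup n)).lapMatrix ℝ).map Complex.ofRealHom
        = (generatingGraph (DihedralGroup n)).lapMatrix ℂ := by
      ext i j
      simp only [SimpleGraph.lapMatrix, SimpleGraph.degMatrix, Matrix.map_apply,
        Matrix.sub_apply, Matrix.diagonal_apply, SimpleGraph.adjMatrix_apply]
      split_ifs <;> simp
    rw [← Matrix.charpoly_map, hmap]
    -- The Schur complement formula excludes only `x = 0` and `x = n`, so infinitely many evaluation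
    -- points remain.
    apply Polynomial.eq_of_infinite_eval_eq
    refine Set.Infinite.mono (s := ({0, (n : ℂ)} : Set ℂ)ᶜ) (fun x hx => ?_)
      (Set.Finite.infinite_compl (by simp))
    simp only [Set.mem_compl_iff, Set.mem_insert_iff, Set.mem_singleton_iff, not_or] at hx
    rw [Set.mem_ofPred_eq, DihedralGroup.eval_charpoly_lapMatrix_generatingGraph hx.1 hx.2,
      prod_divisors_erase_one_pow_totient (NeZero.ne n) _ (x - 2 * (n.totient : ℂ))
        fun d hd => by simp [ArithmeticFunction.moebius_eq_zero_of_not_squarefree hd], hS]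
    have hsum : ∀ (s : Finset ℕ) (g : ℕ → Multiset ℝ) (F : ℝ → Polynomial ℝ),
        (∑ d ∈ s, g d).map F = ∑ d ∈ s, (g d).map F :=
      fun s g F => map_sum (Multiset.mapAddMonoidHom F) g s
    simp only [Multiset.map_add, Multiset.prod_add, Multiset.map_replicate,
      Multiset.prod_replicate, hsum, Multiset.prod_sum, Polynomial.map_mul,
      Polynomial.map_pow, Polynomial.map_prod, Polynomial.map_sub, Polynomial.map_X,
      Polynomial.map_C, Polynomial.eval_mul, Polynomial.eval_pow, Polynomial.eval_prod,
      Polynomial.eval_sub, Polynomial.eval_X, Polynomial.eval_C]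
    simp
    ring
  · intro h x hx
    rw [h] at hx
    simp only [Multiset.mem_add, Multiset.mem_sum, Finset.mem_filter] at hx
    rcases hx with (((hx | ⟨d, ⟨hd, -⟩, hx⟩) | hx) | hx) | hx
    all_goals replace hx := Multiset.eq_of_mem_replicate hx
    · exact ⟨0, by simpa using hx⟩
    · have hdn : d ∣ n := (Nat.dvd_of_mem_divisors hd).trans (squarefreeKernel_dvd n)
      -- Integrality comes from `φ(d) ∣ φ(n)` for `d ∣ n`.
      obtain ⟨c, hc⟩ := Nat.totient_dvd_of_dvd hdn
      have h0 : (d.totient : ℝ) ≠ 0 := Nat.cast_ne_zero.2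
        (Nat.totient_pos.2 (Nat.pos_of_mem_divisors hd)).ne'
      refine ⟨2 * n.totient - ArithmeticFunction.moebius d * c, ?_⟩
      rw [hx, hc]
      push_cast
      field_simp
    · exact ⟨2 * n.totient, by rw [hx]; push_cast; rfl⟩
    · exact ⟨n, by rw [hx]; push_cast; rfl⟩
    · exact ⟨n + n.totient, by rw [hx]; push_cast; rfl⟩
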